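/- Let $q$ be a complex number with $|q|<1$. Write $(a;q)_n=\prod_{m=0}^{n-1}(1-aq^m)$ for integers $n\ge 0$, $(a;q)_\infty=\prod_{m=0}^{\infty}(1-aq^m)$, and $(a,b,c;q)_\infty=(a;q)_\infty(b;q)_\infty(c;q)_\infty$. Then the triple series below converges absolutely and $$\sum_{i,j,k\ge 0}\frac{q^{i^2+2j^2+4k^2+2ik+4jk+2j+2k}\left(1+q^{2i+2j+4k+2}\right)}{(q^2;q^2)_i\,(q^2;q^2)_j\,(q^4;q^4)_k}=\frac{(q^3,q^8,q^{11};q^{11})_\infty}{(q;q^2)_\infty\,(q^4;q^4)_\infty}.$$ -/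

import Mathlib

/-- The finite `q`-shifted factorial `(a;q)_n = (1 - a)(1 - a q) ⋯ (1 - a q^(n-1))`. -/
noncomputable def qPoch (a q : ℂ) (n : ℕ) : ℂ :=
  ∏ k ∈ Finset.range n, (1 - a * q ^ k)

/-- The infinite `q`-shifted factorial `(a;q)_∞ = ∏_{k ≥ 0} (1 - a q^k)`, used for `‖q‖ < 1`,
where the product converges absolutely (see `multipliable_qPochInf`). -/
noncomputable def qPochInf (a q : ℂ) : ℂ :=
  ∏' k : ℕ, (1 - a * q ^ k)

/-- The infinite product defining `(a;q)_∞` converges for `‖q‖ < 1`. -/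
theorem multipliable_qPochInf (a q : ℂ) (hq : ‖q‖ < 1) :
    Multipliable (fun k : ℕ => 1 - a * q ^ k) := by
  have h : Summable (fun k : ℕ => ‖-(a * q ^ k)‖) := by
    simp only [norm_neg, norm_mul, norm_pow]
    exact (summable_geometric_of_lt_one (norm_nonneg q) hq).mul_left _
  simpa [sub_eq_add_neg] using multipliable_one_add_of_summable h

/-- The compressed notation `(a, b, c; q)_∞ = (a;q)_∞ (b;q)_∞ (c;q)_∞`. -/
noncomputable def qPochInf₃ (a b c q : ℂ) : ℂ :=
  qPochInf a q * qPochInf b q * qPochInf c q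

open Filter Topology

/-! Put `q = p ^ 2` and `Q = q ^ 2 = p ^ 4`. The sum over `i` is Euler's: the two terms of `1 + q ^
(2i+2j+4k+2)` give `(-q;q²)_∞ / (-q;q²)_k` and `(-q;q²)_∞ / (-q;q²)_{k+1}`. What remains is a double
series in `N = j + k` and `k`, treated by Bailey's method.

The numbers `1 / ((q⁴;q⁴)_k (-q;q²)_k)` and `1 / ((q⁴;q⁴)_k (-q;q²)_{k+1})` are the `β` sides of two
Bailey pairs sharing the theta coefficients `(-1)^r p^(3r²+r)` (`finTheta_bailey_pair_eq`). One step
of the chain (`tsum_mul_finTheta`, resting on the `q`-Vandermonde sum) turns the exponents into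
`7r²+r` and `7r²+5r`. The recurrence `qInv_sub_one` merges the two results into one series with
exponent `7r²+r` (`tsum_doubleTerm_right`). Summing over `N` as well gives `∑ (-1)^r p^(11r²+5r) /
(Q;Q)_∞` (`tsum_doubleTerm`).

The Jacobi triple product (`tsum_thetaTerm`) evaluates this theta series, and `(-q;q²)_∞ (q;q²)_∞
(q⁴;q⁴)_∞ = (q²;q²)_∞` clears the prefactor.

All sums run over `ℤ`, with `1/(Q;Q)_n = 0` for `n < 0`, so that shifts of the index are plain
reindexings. -/

/-! ### Summability of theta series -/

theorem summable_zpow_quadratic {x : ℝ} (hx0 : 0 < x) (hx1 : x < 1) {a : ℤ} (ha : 0 < a) (b : ℤ) :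
    Summable fun r : ℤ => x ^ (a * r ^ 2 + b * r) := by
  have hs : Summable fun r : ℤ => x ^ r.natAbs := by
    refine Summable.of_nat_of_neg ?_ ?_ <;>
    simpa using summable_geometric_of_lt_one hx0.le hx1
  refine Summable.of_nonneg_of_le (fun r => (zpow_pos hx0 _).le) (fun r => ?_)
    -- Since `a ≥ 1`, `a r² + b r ≥ r² - |b| |r| ≥ |r| - (|b| + 1)²`.
    (hs.mul_left (x ^ (-(|b| + 1) ^ 2)))
  rw [← zpow_natCast x, ← zpow_add₀ hx0.ne']
  refine zpow_le_zpow_right_of_le_one₀ hx0 hx1.le ?_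
  rw [Int.natCast_natAbs]
  have h1 : -(|b| * |r|) ≤ b * r := by rw [← abs_mul]; exact neg_abs_le _
  have h2 : |r| ^ 2 = r ^ 2 := sq_abs r
  nlinarith [sq_nonneg (|r| - (|b| + 1)), abs_nonneg r, abs_nonneg b, sq_nonneg r,
    sq_nonneg (|b| + 1), mul_nonneg (abs_nonneg r) (abs_nonneg b)]

theorem norm_neg_one_zpow (r : ℤ) : ‖(-1 : ℂ) ^ r‖ = 1 := by
  rw [norm_zpow, norm_neg, norm_one, one_zpow]

/-- The general term of a theta series. -/
noncomputable def thetaTerm (p : ℂ) (a b r : ℤ) : ℂ := (-1) ^ r * p ^ (a * r ^ 2 + b * r)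

theorem norm_thetaTerm (p : ℂ) (a b r : ℤ) : ‖thetaTerm p a b r‖ = ‖p‖ ^ (a * r ^ 2 + b * r) := by
  rw [thetaTerm, norm_mul, norm_neg_one_zpow, one_mul, norm_zpow]

theorem summable_norm_thetaTerm {p : ℂ} (hp0 : p ≠ 0) (hp1 : ‖p‖ < 1) {a : ℤ} (ha : 0 < a) (b : ℤ) :
    Summable fun r : ℤ => ‖thetaTerm p a b r‖ := by
  simp_rw [norm_thetaTerm]
  exact summable_zpow_quadratic (norm_pos_iff.2 hp0) hp1 ha b

theorem Summable.mul_norm_bounded {ι : Type*} {w f : ι → ℂ} {C : ℝ} (hw : Summable fun r => ‖w r‖)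
    (hf : ∀ r, ‖f r‖ ≤ C) : Summable fun r => w r * f r := by
  refine Summable.of_norm_bounded (hw.mul_right C) fun r => ?_
  rw [norm_mul]
  exact mul_le_mul_of_nonneg_left (hf r) (norm_nonneg _)

/-! ### `q`-shifted factorials and their reciprocals -/

theorem one_sub_pow_ne_zero {Q : ℂ} (hQ : ‖Q‖ < 1) {n : ℕ} (hn : n ≠ 0) : 1 - Q ^ n ≠ 0 := by
  intro h
  have : ‖Q ^ n‖ = 1 := by rw [← sub_eq_zero.1 h, norm_one]
  rw [norm_pow] at this
  exact (pow_lt_one₀ (norm_nonneg _) hQ hn).ne this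

theorem one_sub_mul_pow_ne_zero {a Q : ℂ} (ha : ‖a‖ < 1) (hQ : ‖Q‖ < 1) (n : ℕ) :
    1 - a * Q ^ n ≠ 0 := by
  intro h
  have : ‖a * Q ^ n‖ = 1 := by rw [← sub_eq_zero.1 h, norm_one]
  rw [norm_mul, norm_pow] at this
  have h2 := pow_le_one₀ (n := n) (norm_nonneg _) hQ.le
  nlinarith [norm_nonneg a, pow_nonneg (norm_nonneg Q) n]

theorem qPoch_zero (a q : ℂ) : qPoch a q 0 = 1 := by simp [qPoch]

theorem qPoch_succ (a q : ℂ) (n : ℕ) : qPoch a q (n + 1) = qPoch a q n * (1 - a * q ^ n) := by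
  simp [qPoch, Finset.prod_range_succ]

theorem qPoch_ne_zero {a Q : ℂ} (ha : ‖a‖ < 1) (hQ : ‖Q‖ < 1) (n : ℕ) : qPoch a Q n ≠ 0 :=
  Finset.prod_ne_zero_iff.2 fun k _ => one_sub_mul_pow_ne_zero ha hQ k

theorem tendsto_qPoch (a : ℂ) {q : ℂ} (hq : ‖q‖ < 1) :
    Tendsto (qPoch a q) atTop (𝓝 (qPochInf a q)) :=
  (multipliable_qPochInf a q hq).tendsto_prod_tprod_nat

theorem qPochInf_ne_zero {a Q : ℂ} (ha : ‖a‖ < 1) (hQ : ‖Q‖ < 1) : qPochInf a Q ≠ 0 := by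
  have h := tprod_one_add_ne_zero_of_summable (f := fun k : ℕ => -(a * Q ^ k))
    (fun k => by simpa [sub_eq_add_neg] using one_sub_mul_pow_ne_zero ha hQ k)
    (by
      simp only [norm_neg, norm_mul, norm_pow]
      exact (summable_geometric_of_lt_one (norm_nonneg Q) hQ).mul_left _)
  simpa [qPochInf, sub_eq_add_neg] using h

theorem exists_norm_inv_qPoch_le {a Q : ℂ} (ha : ‖a‖ < 1) (hQ : ‖Q‖ < 1) :
    ∃ C : ℝ, 0 < C ∧ ∀ n, ‖(qPoch a Q n)⁻¹‖ ≤ C := by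
  obtain ⟨C, hC⟩ := ((tendsto_qPoch a hQ).inv₀ (qPochInf_ne_zero ha hQ)).norm.bddAbove_range
  refine ⟨max C 1, by positivity, fun n => le_max_of_le_left (hC ⟨n, rfl⟩)⟩

/-- The reciprocal `1 / (Q;Q)_n`, extended by zero to negative `n`. -/
noncomputable def qInv (Q : ℂ) (n : ℤ) : ℂ := if n < 0 then 0 else (qPoch Q Q n.toNat)⁻¹

theorem qInv_of_neg (Q : ℂ) {n : ℤ} (hn : n < 0) : qInv Q n = 0 := if_pos hn

theorem qInv_natCast (Q : ℂ) (n : ℕ) : qInv Q n = (qPoch Q Q n)⁻¹ := by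
  simp [qInv]

theorem qInv_zero (Q : ℂ) : qInv Q 0 = 1 := by simp [qInv, qPoch_zero]

/-- At `n = 0` the factor `1 - Q ^ 0` vanishes, matching the value zero at `-1`. The recurrence
therefore holds on all of `ℤ`, and later manipulations have no boundary terms. -/
theorem qInv_sub_one {Q : ℂ} (hQ : ‖Q‖ < 1) (n : ℤ) : qInv Q (n - 1) = (1 - Q ^ n) * qInv Q n := by
  rcases lt_trichotomy n 0 with h | rfl | h
  · rw [qInv_of_neg Q h, qInv_of_neg Q (by omega), mul_zero]
  · rw [qInv_of_neg Q (by omega), zpow_zero, sub_self, zero_mul]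
  · obtain ⟨m, rfl⟩ : ∃ m : ℕ, n = (m + 1 : ℕ) := ⟨(n - 1).toNat, by omega⟩
    have h1 := one_sub_pow_ne_zero hQ (Nat.succ_ne_zero m)
    have h2 : ((m + 1 : ℕ) : ℤ) - 1 = m := by omega
    rw [h2, qInv_natCast, qInv_natCast, qPoch_succ, zpow_natCast, mul_inv,
      ← pow_succ' Q m, mul_comm, mul_assoc, inv_mul_cancel₀ h1, mul_one]

theorem exists_norm_qInv_le {Q : ℂ} (hQ : ‖Q‖ < 1) : ∃ C : ℝ, 0 < C ∧ ∀ n, ‖qInv Q n‖ ≤ C := by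
  obtain ⟨C, hC0, hC⟩ := exists_norm_inv_qPoch_le hQ hQ
  refine ⟨C, hC0, fun n => ?_⟩
  unfold qInv
  split_ifs
  · simpa using hC0.le
  · exact hC _

theorem tendsto_qInv {Q : ℂ} (hQ : ‖Q‖ < 1) {f : ℕ → ℤ} (hf : Tendsto f atTop atTop) :
    Tendsto (fun n => qInv Q (f n)) atTop (𝓝 (qPochInf Q Q)⁻¹) := by
  have h1 : Tendsto (fun n => (qPoch Q Q (f n).toNat)⁻¹) atTop (𝓝 (qPochInf Q Q)⁻¹) :=
    (((tendsto_qPoch Q hQ).inv₀ (qPochInf_ne_zero hQ hQ))).comp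
      ((tendsto_atTop_atTop.2 fun b => ⟨b, fun a ha => by omega⟩ :
        Tendsto Int.toNat atTop atTop).comp hf)
  refine h1.congr' ?_
  filter_upwards [hf.eventually_ge_atTop 0] with n hn
  rw [qInv, if_neg (by omega)]

/-! ### The bilateral `q`-Vandermonde sum and Bailey's lemma -/

theorem norm_mul_le_of_le_bound {x y : ℂ} {C : ℝ} (hC : 0 < C) (hx : ‖x‖ ≤ C) (hy : ‖y‖ ≤ C) :
    ‖x * y‖ ≤ C * C := by
  rw [norm_mul]; exact mul_le_mul hx hy (norm_nonneg _) hC.le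

theorem norm_mul_mul_le_of_le_bound {x y z : ℂ} {C : ℝ} (hC : 0 < C) (hx : ‖x‖ ≤ C) (hy : ‖y‖ ≤ C) (hz : ‖z‖ ≤ C) :
    ‖x * y * z‖ ≤ C * C * C := by
  rw [norm_mul]
  exact mul_le_mul (norm_mul_le_of_le_bound hC hx hy) hz (norm_nonneg _) (mul_pos hC hC).le

theorem summable_norm_zpow_quadratic {p : ℂ} (hp0 : p ≠ 0) (hp1 : ‖p‖ < 1) {a : ℤ} (ha : 0 < a)
    (b : ℤ) : Summable fun r : ℤ => ‖p ^ (a * r ^ 2 + b * r)‖ := by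
  simp_rw [norm_zpow]
  exact summable_zpow_quadratic (norm_pos_iff.2 hp0) hp1 ha b

/-- The bilateral form of the `q`-Vandermonde sum. -/
noncomputable def vandermondeSum (Q : ℂ) (m s : ℤ) : ℂ :=
  ∑' t : ℤ, Q ^ (1 * t ^ 2 + s * t) * (qInv Q (m - t) * qInv Q t * qInv Q (t + s))

theorem summable_vandermondeSum {Q : ℂ} (hQ0 : Q ≠ 0) (hQ : ‖Q‖ < 1) (b m m' m'' : ℤ) :
    Summable fun t : ℤ => Q ^ (1 * t ^ 2 + b * t) *
      (qInv Q (m - t) * qInv Q (t + m') * qInv Q (t + m'')) := by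
  obtain ⟨C, hC0, hC⟩ := exists_norm_qInv_le hQ
  exact (summable_norm_zpow_quadratic hQ0 hQ one_pos b).mul_norm_bounded
    fun t => norm_mul_mul_le_of_le_bound hC0 (hC _) (hC _) (hC _)

/-- Split `1 - Q^m = (1 - Q^t) + Q^t (1 - Q^(m-t))` and let each factor lower the index of a
reciprocal factorial. After `t ↦ t + 1` in the first piece, the two pieces recombine through
`1/(Q;Q)_{t+s} = (1 - Q^(t+s+1)) / (Q;Q)_{t+s+1}`. -/
theorem vandermondeSum_rec {Q : ℂ} (hQ0 : Q ≠ 0) (hQ : ‖Q‖ < 1) (m s : ℤ) :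
    (1 - Q ^ m) * vandermondeSum Q m s = vandermondeSum Q (m - 1) (s + 1) := by
  have e1 : (1 - Q ^ m) * vandermondeSum Q m s =
      (∑' t : ℤ, Q ^ (1 * t ^ 2 + s * t) * (qInv Q (m - t) * qInv Q (t + -1) * qInv Q (t + s))) +
      ∑' t : ℤ, Q ^ (1 * t ^ 2 + (s + 1) * t) *
        (qInv Q (m - 1 - t) * qInv Q (t + 0) * qInv Q (t + s)) := by
    rw [← (summable_vandermondeSum hQ0 hQ _ _ _ _).tsum_add (summable_vandermondeSum hQ0 hQ _ _ _ _),
      vandermondeSum, ← tsum_mul_left]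
    refine tsum_congr fun t => ?_
    have h1 := qInv_sub_one hQ t
    have h2 := qInv_sub_one hQ (m - t)
    rw [show m - t - 1 = m - 1 - t by ring] at h2
    rw [← sub_eq_add_neg, add_zero, h1, h2, show 1 * t ^ 2 + (s + 1) * t = (1 * t ^ 2 + s * t) + t by ring,
      zpow_add₀ hQ0 _ t]
    have h3 : Q ^ m = Q ^ t * Q ^ (m - t) := by rw [← zpow_add₀ hQ0]; congr 1; ring
    rw [h3]; ring
  rw [e1, ← (Equiv.addRight (1 : ℤ)).tsum_eq
      fun t => Q ^ (1 * t ^ 2 + s * t) * (qInv Q (m - t) * qInv Q (t + -1) * qInv Q (t + s))]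
  erw [← ((Equiv.addRight (1 : ℤ)).summable_iff.2 (summable_vandermondeSum hQ0 hQ s m (-1) s)).tsum_add
      (summable_vandermondeSum hQ0 hQ _ _ _ _)]
  refine tsum_congr fun t => ?_
  simp only [Function.comp, Equiv.coe_addRight]
  have h1 := qInv_sub_one hQ (t + (s + 1))
  rw [show t + (s + 1) - 1 = t + s by ring] at h1
  rw [h1, show t + 1 + -1 = t by ring, show m - (t + 1) = m - 1 - t by ring, add_zero,
    show t + 1 + s = t + (s + 1) by ring,
    show 1 * (t + 1) ^ 2 + s * (t + 1) = (1 * t ^ 2 + (s + 1) * t) + (t + (s + 1)) by ring,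
    zpow_add₀ hQ0 _ (t + (s + 1))]
  ring

theorem vandermondeSum_eq_nat {Q : ℂ} (hQ0 : Q ≠ 0) (hQ : ‖Q‖ < 1) (m : ℕ) :
    ∀ s : ℤ, vandermondeSum Q m s = qInv Q m * qInv Q (m + s) := by
  induction m with
  | zero =>
    intro s
    rw [vandermondeSum, tsum_eq_single 0]
    · simp [qInv_zero]
    · intro t ht
      rcases lt_or_gt_of_ne ht with h | h
      · rw [qInv_of_neg Q h]; simp
      · rw [qInv_of_neg Q (show ((0 : ℕ) : ℤ) - t < 0 by simpa using h)]; simp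
  | succ m ih =>
    intro s
    have h1 : 1 - Q ^ ((m + 1 : ℕ) : ℤ) ≠ 0 := by
      rw [zpow_natCast]; exact one_sub_pow_ne_zero hQ (Nat.succ_ne_zero m)
    apply mul_left_cancel₀ h1
    have h2 := qInv_sub_one hQ ((m + 1 : ℕ) : ℤ)
    rw [show ((m + 1 : ℕ) : ℤ) - 1 = m by push_cast; ring] at h2
    rw [vandermondeSum_rec hQ0 hQ, show ((m + 1 : ℕ) : ℤ) - 1 = m by push_cast; ring, ih, h2,
      show (m : ℤ) + (s + 1) = ((m + 1 : ℕ) : ℤ) + s by push_cast; ring]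
    ring

theorem vandermondeSum_eq {Q : ℂ} (hQ0 : Q ≠ 0) (hQ : ‖Q‖ < 1) (m s : ℤ) :
    vandermondeSum Q m s = qInv Q m * qInv Q (m + s) := by
  rcases lt_or_ge m 0 with h | h
  · rw [qInv_of_neg Q h, zero_mul, vandermondeSum]
    refine (tsum_congr fun t => ?_).trans tsum_zero
    rcases lt_or_ge t 0 with h' | h'
    · rw [qInv_of_neg Q h']; simp
    · rw [qInv_of_neg Q (show m - t < 0 by omega)]; simp
  · lift m to ℕ using h
    exact vandermondeSum_eq_nat hQ0 hQ m s

theorem tendsto_natCast_add_int (c : ℤ) : Tendsto (fun n : ℕ => (n : ℤ) + c) atTop atTop :=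
  tendsto_atTop_add_const_right _ _ tendsto_natCast_atTop_atTop

/-- The limit `m → ∞` of `vandermondeSum_eq`, by dominated convergence; one of the two factors
`1/(Q;Q)_∞` on the right cancels. -/
theorem tsum_zpow_mul_qInv {Q : ℂ} (hQ0 : Q ≠ 0) (hQ : ‖Q‖ < 1) (s : ℤ) :
    ∑' t : ℤ, Q ^ (1 * t ^ 2 + s * t) * (qInv Q t * qInv Q (t + s)) = (qPochInf Q Q)⁻¹ := by
  obtain ⟨C, hC0, hC⟩ := exists_norm_qInv_le hQ
  set L := (qPochInf Q Q)⁻¹ with hL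
  have hL0 : L ≠ 0 := inv_ne_zero (qPochInf_ne_zero hQ hQ)
  have h1 : Tendsto (fun m : ℕ => vandermondeSum Q m s) atTop
      (𝓝 (∑' t : ℤ, Q ^ (1 * t ^ 2 + s * t) * (L * qInv Q t * qInv Q (t + s)))) := by
    refine tendsto_tsum_of_dominated_convergence
      (bound := fun t => ‖Q ^ (1 * t ^ 2 + s * t)‖ * (C * C * C))
      ((summable_norm_zpow_quadratic hQ0 hQ one_pos s).mul_right _) (fun t => ?_)
      (Eventually.of_forall fun m t => ?_)
    · exact (((tendsto_qInv hQ (by simpa [sub_eq_add_neg] using tendsto_natCast_add_int (-t))).mul_const _).mul_const _).const_mul _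
    · rw [norm_mul]
      exact mul_le_mul_of_nonneg_left (norm_mul_mul_le_of_le_bound hC0 (hC _) (hC _) (hC _)) (norm_nonneg _)
  have h2 : Tendsto (fun m : ℕ => vandermondeSum Q m s) atTop (𝓝 (L * L)) := by
    simp_rw [vandermondeSum_eq hQ0 hQ]
    exact (tendsto_qInv hQ tendsto_natCast_atTop_atTop).mul (tendsto_qInv hQ (tendsto_natCast_add_int s))
  have h3 := tendsto_nhds_unique h1 h2
  apply mul_left_cancel₀ hL0
  rw [← h3, ← tsum_mul_left]
  exact tsum_congr fun t => by ring

/-- Substituting `k = t + r` turns this into `vandermondeSum` with parameters `N - r` and `2r + e`.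
It is the kernel of the Bailey chain; `e = 0` and `e = 1` are the cases relative to `1` and to `Q`.
-/
theorem tsum_bailey {Q : ℂ} (hQ0 : Q ≠ 0) (hQ : ‖Q‖ < 1) (N r e : ℤ) :
    ∑' k : ℤ, Q ^ (k ^ 2 + e * k) * (qInv Q (N - k) * (qInv Q (k - r) * qInv Q (k + r + e))) =
      Q ^ (r ^ 2 + e * r) * (qInv Q (N - r) * qInv Q (N + r + e)) := by
  have h := vandermondeSum_eq hQ0 hQ (N - r) (2 * r + e)
  rw [show N - r + (2 * r + e) = N + r + e by ring] at h
  rw [← h, ← (Equiv.addRight r).tsum_eq, vandermondeSum, ← tsum_mul_left]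
  refine tsum_congr fun t => ?_
  simp only [Equiv.coe_addRight]
  rw [show t + r + r + e = t + (2 * r + e) by ring, show t + r - r = t by ring,
    show N - (t + r) = N - r - t by ring,
    show (t + r) ^ 2 + e * (t + r) = (r ^ 2 + e * r) + (1 * t ^ 2 + (2 * r + e) * t) by ring,
    zpow_add₀ hQ0]
  ring

theorem tsum_bailey_limit {Q : ℂ} (hQ0 : Q ≠ 0) (hQ : ‖Q‖ < 1) (r e : ℤ) :
    ∑' k : ℤ, Q ^ (k ^ 2 + e * k) * (qInv Q (k - r) * qInv Q (k + r + e)) =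
      Q ^ (r ^ 2 + e * r) * (qPochInf Q Q)⁻¹ := by
  rw [← tsum_zpow_mul_qInv hQ0 hQ (2 * r + e), ← (Equiv.addRight r).tsum_eq, ← tsum_mul_left]
  refine tsum_congr fun t => ?_
  simp only [Equiv.coe_addRight]
  rw [show t + r + r + e = t + (2 * r + e) by ring, show t + r - r = t by ring,
    show (t + r) ^ 2 + e * (t + r) = (r ^ 2 + e * r) + (1 * t ^ 2 + (2 * r + e) * t) by ring,
    zpow_add₀ hQ0]
  ring

/-! ### The finite and infinite Jacobi triple product -/

/-- The finite theta series `∑ (-1)^r p^(a r² + b r) / ((P;P)_{n-r} (P;P)_{m+r})`. -/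
noncomputable def finTheta (p P : ℂ) (a b n m : ℤ) : ℂ :=
  ∑' r : ℤ, thetaTerm p a b r * (qInv P (n - r) * qInv P (m + r))

theorem summable_finTheta {p P : ℂ} (hp0 : p ≠ 0) (hp1 : ‖p‖ < 1) (hP : ‖P‖ < 1) {a : ℤ} (ha : 0 < a)
    (b n m : ℤ) : Summable fun r : ℤ => thetaTerm p a b r * (qInv P (n - r) * qInv P (m + r)) := by
  obtain ⟨C, hC0, hC⟩ := exists_norm_qInv_le hP
  exact (summable_norm_thetaTerm hp0 hp1 ha b).mul_norm_bounded
    fun t => norm_mul_le_of_le_bound hC0 (hC _) (hC _)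

theorem thetaTerm_mul {p : ℂ} (hp0 : p ≠ 0) (a b c r : ℤ) :
    thetaTerm p a b r * p ^ (c * r) = thetaTerm p a (b + c) r := by
  rw [thetaTerm, thetaTerm, mul_assoc, ← zpow_add₀ hp0]; congr 2; ring

theorem thetaTerm_add_one {p : ℂ} (hp0 : p ≠ 0) (a b r : ℤ) :
    thetaTerm p a b (r + 1) = -p ^ (a + b) * thetaTerm p a (b + 2 * a) r := by
  rw [thetaTerm, thetaTerm, zpow_add_one₀ (by norm_num),
    show a * (r + 1) ^ 2 + b * (r + 1) = (a + b) + (a * r ^ 2 + (b + 2 * a) * r) by ring,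
    zpow_add₀ hp0]
  ring

theorem thetaTerm_neg (p : ℂ) (a b r : ℤ) : thetaTerm p a b (-r) = thetaTerm p a (-b) r := by
  rw [thetaTerm, thetaTerm, zpow_neg, ← inv_zpow]
  congr 2
  · norm_num
  · ring

theorem finTheta_shift {p P : ℂ} (hp0 : p ≠ 0) (a b n m : ℤ) :
    finTheta p P a b n m = -p ^ (a + b) * finTheta p P a (b + 2 * a) (n - 1) (m + 1) := by
  rw [finTheta, finTheta, ← (Equiv.addRight (1 : ℤ)).tsum_eq, ← tsum_mul_left]
  refine tsum_congr fun t => ?_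
  simp only [Equiv.coe_addRight]
  rw [thetaTerm_add_one hp0, show n - (t + 1) = n - 1 - t by ring,
    show m + (t + 1) = m + 1 + t by ring]
  ring

theorem finTheta_neg (p P : ℂ) (a b n m : ℤ) : finTheta p P a b n m = finTheta p P a (-b) m n := by
  rw [finTheta, finTheta, ← (Equiv.neg ℤ).tsum_eq]
  refine tsum_congr fun t => ?_
  simp only [Equiv.neg_apply]
  rw [thetaTerm_neg, sub_neg_eq_add, ← sub_eq_add_neg, mul_comm (qInv P _)]

/-- `1 / (P;P)_{n-r-1} = (1 - P^{n-r}) / (P;P)_{n-r}` applied termwise. -/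
theorem finTheta_sub_one_left {p : ℂ} (hp0 : p ≠ 0) (hp1 : ‖p‖ < 1) {d : ℕ} (hd : d ≠ 0) {a : ℤ}
    (ha : 0 < a) (b n m : ℤ) :
    finTheta p (p ^ d) a b (n - 1) m =
      finTheta p (p ^ d) a b n m - p ^ (d * n) * finTheta p (p ^ d) a (b - d) n m := by
  have hP : ‖p ^ d‖ < 1 := by rw [norm_pow]; exact pow_lt_one₀ (norm_nonneg _) hp1 hd
  rw [finTheta, finTheta, finTheta, ← tsum_mul_left, ← (summable_finTheta hp0 hp1 hP ha _ _ _).tsum_sub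
    ((summable_finTheta hp0 hp1 hP ha _ _ _).mul_left _)]
  refine tsum_congr fun t => ?_
  have h := qInv_sub_one hP (n - t)
  rw [← zpow_natCast, ← zpow_mul, show (d : ℤ) * (n - t) = d * n + (-d) * t by ring,
    zpow_add₀ hp0] at h
  rw [sub_eq_add_neg b, ← thetaTerm_mul hp0, show n - 1 - t = n - t - 1 by ring, ← zpow_natCast, h]
  ring

theorem finTheta_sub_one_right {p : ℂ} (hp0 : p ≠ 0) (hp1 : ‖p‖ < 1) {d : ℕ} (hd : d ≠ 0) {a : ℤ}
    (ha : 0 < a) (b n m : ℤ) :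
    finTheta p (p ^ d) a b n (m - 1) =
      finTheta p (p ^ d) a b n m - p ^ (d * m) * finTheta p (p ^ d) a (b + d) n m := by
  rw [finTheta_neg, finTheta_sub_one_left hp0 hp1 hd ha, finTheta_neg, finTheta_neg _ _ _ (-b - d)]
  simp only [neg_neg, neg_sub, sub_neg_eq_add]
  rw [add_comm (d : ℤ) b]

/-- When `d = 2a`, the index shift moves `b` by exactly `d`, so `finTheta_shift` and the two
contiguous relations form a closed system, from which the series with parameter `b - d` is
eliminated. -/
theorem finTheta_rec_left {p : ℂ} (hp0 : p ≠ 0) (hp1 : ‖p‖ < 1) {d : ℕ} {a : ℤ}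
    (ha : 0 < a) (hda : (d : ℤ) = 2 * a) (b n m : ℤ) :
    (1 - p ^ (d * (n + m))) * finTheta p (p ^ d) a b n m =
      (1 - p ^ (a + b) * p ^ (d * (n - 1))) * finTheta p (p ^ d) a b (n - 1) m := by
  have hd : d ≠ 0 := by omega
  have h1 := finTheta_sub_one_left hp0 hp1 hd ha b n m
  have h2 := finTheta_sub_one_right hp0 hp1 hd ha (b - d) n m
  have h3 := finTheta_shift (P := p ^ d) hp0 a (b - d) n (m - 1)
  rw [show b - d + d = b by ring] at h2
  rw [show b - d + 2 * a = b by omega, show m - 1 + 1 = m by ring] at h3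
  have e1 : p ^ (d * (n + m)) = p ^ (d * n) * p ^ (d * m) := by
    rw [← zpow_add₀ hp0]; congr 1; ring
  have e2 : p ^ (a + b) * p ^ (d * (n - 1)) = p ^ (d * n) * p ^ (a + (b - d)) := by
    rw [← zpow_add₀ hp0, ← zpow_add₀ hp0]; congr 1; ring
  rw [e1, e2]
  linear_combination -h1 - p ^ (d * n) * h2 + p ^ (d * n) * h3

theorem finTheta_rec_right {p : ℂ} (hp0 : p ≠ 0) (hp1 : ‖p‖ < 1) {d : ℕ} {a : ℤ}
    (ha : 0 < a) (hda : (d : ℤ) = 2 * a) (b n m : ℤ) :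
    (1 - p ^ (d * (n + m))) * finTheta p (p ^ d) a b n m =
      (1 - p ^ (a - b) * p ^ (d * (m - 1))) * finTheta p (p ^ d) a b n (m - 1) := by
  have h := finTheta_rec_left hp0 hp1 ha hda (-b) m n
  rwa [finTheta_neg _ _ _ _ m n, finTheta_neg _ _ _ _ _ n, neg_neg, ← sub_eq_add_neg,
    add_comm m n] at h

theorem finTheta_zero (p P : ℂ) (a b : ℤ) : finTheta p P a b 0 0 = 1 := by
  rw [finTheta, tsum_eq_single 0]
  · simp [qInv_zero, thetaTerm]
  · intro t ht
    rcases lt_or_gt_of_ne ht with h | h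
    · rw [qInv_of_neg P (show 0 + t < 0 by omega)]; simp
    · rw [qInv_of_neg P (show 0 - t < 0 by omega)]; simp

theorem finTheta_eq {p : ℂ} (hp0 : p ≠ 0) (hp1 : ‖p‖ < 1) {d : ℕ} {a : ℤ}
    (ha : 0 < a) (hda : (d : ℤ) = 2 * a) (b : ℤ) (n m : ℕ) :
    finTheta p (p ^ d) a b n m =
      qPoch (p ^ (a + b)) (p ^ d) n * qPoch (p ^ (a - b)) (p ^ d) m * qInv (p ^ d) (n + m) := by
  have hP : ‖p ^ d‖ < 1 := by rw [norm_pow]; exact pow_lt_one₀ (norm_nonneg _) hp1 (by omega)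
  have hz (k : ℕ) : p ^ ((d : ℤ) * k) = (p ^ d) ^ k := by rw [← pow_mul]; norm_cast
  induction m with
  | zero =>
    induction n with
    | zero => simpa [qPoch_zero, qInv_zero] using finTheta_zero p (p ^ d) a b
    | succ n ih =>
      have h1 := finTheta_rec_left hp0 hp1 ha hda b (n + 1 : ℕ) (0 : ℕ)
      have h2 := qInv_sub_one hP ((n + 1 : ℕ) : ℤ)
      rw [← Nat.cast_add, hz, show ((n + 1 : ℕ) : ℤ) - 1 = n by push_cast; ring, ih, hz,
        add_zero] at h1
      rw [show ((n + 1 : ℕ) : ℤ) - 1 = n by push_cast; ring, zpow_natCast] at h2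
      rw [← mul_right_inj' (one_sub_pow_ne_zero hP (show n + 1 ≠ 0 by omega)), h1, qPoch_succ]
      simp only [Nat.cast_zero, add_zero, h2]
      ring
  | succ m ih =>
    have h1 := finTheta_rec_right hp0 hp1 ha hda b n (m + 1 : ℕ)
    have h2 := qInv_sub_one hP ((n + (m + 1) : ℕ) : ℤ)
    rw [← Nat.cast_add, hz, show ((m + 1 : ℕ) : ℤ) - 1 = m by push_cast; ring, ih, hz] at h1
    rw [show ((n + (m + 1) : ℕ) : ℤ) - 1 = n + m by push_cast; ring, zpow_natCast] at h2
    rw [← mul_right_inj' (one_sub_pow_ne_zero hP (show n + (m + 1) ≠ 0 by omega)), h1, qPoch_succ,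
      h2]
    push_cast
    ring

/-- The Jacobi triple product identity. -/
theorem tsum_thetaTerm {p : ℂ} (hp0 : p ≠ 0) (hp1 : ‖p‖ < 1) {d : ℕ} {a : ℤ}
    (ha : 0 < a) (hda : (d : ℤ) = 2 * a) (b : ℤ) :
    ∑' r : ℤ, thetaTerm p a b r =
      qPochInf (p ^ (a + b)) (p ^ d) * qPochInf (p ^ (a - b)) (p ^ d) *
        qPochInf (p ^ d) (p ^ d) := by
  have hP : ‖p ^ d‖ < 1 := by rw [norm_pow]; exact pow_lt_one₀ (norm_nonneg _) hp1 (by omega)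
  obtain ⟨C, hC0, hC⟩ := exists_norm_qInv_le hP
  have hL0 : qPochInf (p ^ d) (p ^ d) ≠ 0 := qPochInf_ne_zero hP hP
  set L := qPochInf (p ^ d) (p ^ d) with hL
  -- The diagonal limit `n = m → ∞` is computed twice: termwise here, and from the product formula
  -- `finTheta_eq` in `h2`.
  have h1 : Tendsto (fun n : ℕ => finTheta p (p ^ d) a b n n) atTop
      (𝓝 (∑' r : ℤ, thetaTerm p a b r * (L⁻¹ * L⁻¹))) := by
    refine tendsto_tsum_of_dominated_convergence
      (bound := fun r => ‖thetaTerm p a b r‖ * (C * C))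
      ((summable_norm_thetaTerm hp0 hp1 ha b).mul_right _) (fun r => ?_)
      (Eventually.of_forall fun m r => ?_)
    · exact ((tendsto_qInv hP (by simpa [sub_eq_add_neg] using tendsto_natCast_add_int (-r))).mul
        (tendsto_qInv hP (tendsto_natCast_add_int r))).const_mul _
    · rw [norm_mul]
      exact mul_le_mul_of_nonneg_left (norm_mul_le_of_le_bound hC0 (hC _) (hC _)) (norm_nonneg _)
  have h2 : Tendsto (fun n : ℕ => finTheta p (p ^ d) a b n n) atTop
      (𝓝 (qPochInf (p ^ (a + b)) (p ^ d) * qPochInf (p ^ (a - b)) (p ^ d) * L⁻¹)) := by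
    simp_rw [finTheta_eq hp0 hp1 ha hda]
    exact ((tendsto_qPoch _ hP).mul (tendsto_qPoch _ hP)).mul
      (tendsto_qInv hP (tendsto_natCast_atTop_atTop.atTop_add_nonneg fun _ => by positivity))
  have h3 := tendsto_nhds_unique h1 h2
  rw [tsum_mul_right] at h3
  field_simp at h3
  linear_combination h3

/-! ### The two Bailey pairs -/

/-- Here `d = 4` differs from `2a = 6`, so `finTheta_eq` does not apply. Instead, negation followed
by a shift gives the reflection `c ↦ 6 - c` of the linear parameter at `(n, n + 1)`, and the
contiguous relations reduce everything to the parameter `1`. -/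
theorem finTheta_bailey_pair {p : ℂ} (hp0 : p ≠ 0) (hp1 : ‖p‖ < 1) (n : ℤ) :
    finTheta p (p ^ 4) 3 1 n n = (1 + p ^ (4 * n + 2)) * finTheta p (p ^ 4) 3 1 n (n + 1) ∧
      finTheta p (p ^ 4) 3 1 (n - 1) n = (1 - p ^ (8 * n)) * finTheta p (p ^ 4) 3 1 n n := by
  have hr (c : ℤ) := finTheta_sub_one_right hp0 hp1 (d := 4) (by norm_num) three_pos c n (n + 1)
  have hl := finTheta_sub_one_left hp0 hp1 (d := 4) (by norm_num) three_pos 1 n n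
  have hg (c : ℤ) : finTheta p (p ^ 4) 3 c n (n + 1) =
      -p ^ (3 - c) * finTheta p (p ^ 4) 3 (6 - c) n (n + 1) := by
    rw [finTheta_neg, finTheta_shift hp0]
    ring_nf
  have r1 := hr 1
  have r3 := hr 3
  have rm1 := hr (-1)
  have n1 := finTheta_neg p (p ^ 4) 3 (-1) n n
  have n3 := finTheta_neg p (p ^ 4) 3 (-3) n n
  have g3 := hg 3
  have g5 := hg 5
  have g7 := hg 7
  norm_num at r1 r3 rm1 n1 n3 g3 g5 g7 hl
  -- `c = 3` is the fixed point of the reflection, which there has sign `-1`.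
  have g3' : finTheta p (p ^ 4) 3 3 n (n + 1) = 0 := by linear_combination g3 / 2
  rw [g3'] at rm1 r3
  have e1 : p ^ (4 * (n + 1)) = p ^ (4 * n) * p ^ (4 : ℤ) := by rw [← zpow_add₀ hp0]; congr 1; ring
  have e2 : p ^ (4 * n + 2) = p ^ (4 * n) * p ^ 2 := by
    rw [zpow_add₀ hp0]; norm_cast
  have e3 : p ^ (8 * n) = p ^ (4 * n) * p ^ (4 * n) := by rw [← zpow_add₀ hp0]; congr 1; ring
  have f1 : finTheta p (p ^ 4) 3 (-1) n (n + 1) = finTheta p (p ^ 4) 3 1 n n := by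
    linear_combination n1 - rm1
  rw [g5, e1] at r1
  rw [g7, e1, f1] at r3
  rw [e2, e3]
  constructor
  · rw [r1]
    field_simp
    norm_cast
    ring
  · rw [hl, n3, r3]
    field_simp
    norm_cast
    ring

/-- The two relations of `finTheta_bailey_pair` alternate, climbing from `(n, n)` to `(n, n + 1)`
and then to `(n + 1, n + 1)`. -/
theorem finTheta_bailey_pair_eq {p : ℂ} (hp0 : p ≠ 0) (hp1 : ‖p‖ < 1) (n : ℕ) :
    finTheta p (p ^ 4) 3 1 n n = (qPoch (p ^ 8) (p ^ 8) n * qPoch (-p ^ 2) (p ^ 4) n)⁻¹ ∧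
      finTheta p (p ^ 4) 3 1 n (n + 1) =
        (qPoch (p ^ 8) (p ^ 8) n * qPoch (-p ^ 2) (p ^ 4) (n + 1))⁻¹ := by
  have h2 : ‖-p ^ 2‖ < 1 := by
    rw [norm_neg, norm_pow]; exact pow_lt_one₀ (norm_nonneg _) hp1 (by norm_num)
  have h4 : ‖p ^ 4‖ < 1 := by rw [norm_pow]; exact pow_lt_one₀ (norm_nonneg _) hp1 (by norm_num)
  have h8 : ‖p ^ 8‖ < 1 := by rw [norm_pow]; exact pow_lt_one₀ (norm_nonneg _) hp1 (by norm_num)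
  have key (n : ℕ) (h : finTheta p (p ^ 4) 3 1 n n =
      (qPoch (p ^ 8) (p ^ 8) n * qPoch (-p ^ 2) (p ^ 4) n)⁻¹) :
      finTheta p (p ^ 4) 3 1 n (n + 1) =
        (qPoch (p ^ 8) (p ^ 8) n * qPoch (-p ^ 2) (p ^ 4) (n + 1))⁻¹ := by
    have h0 := one_sub_mul_pow_ne_zero h2 h4 n
    have h1 := (finTheta_bailey_pair hp0 hp1 n).1
    have e : 1 + p ^ (4 * (n : ℤ) + 2) = 1 - -p ^ 2 * (p ^ 4) ^ n := by
      rw [← pow_mul, zpow_add₀ hp0]; norm_cast; ring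
    rw [e, h] at h1
    rw [qPoch_succ, ← mul_assoc, mul_inv, h1, mul_right_comm, mul_inv_cancel₀ h0, one_mul]
  have first : finTheta p (p ^ 4) 3 1 n n =
      (qPoch (p ^ 8) (p ^ 8) n * qPoch (-p ^ 2) (p ^ 4) n)⁻¹ := by
    induction n with
    | zero => simpa [qPoch_zero] using finTheta_zero p (p ^ 4) 3 1
    | succ n ih =>
      have h0 := one_sub_mul_pow_ne_zero h8 h8 n
      have h1 := (finTheta_bailey_pair hp0 hp1 (n + 1 : ℕ)).2
      have e : 1 - p ^ (8 * ((n + 1 : ℕ) : ℤ)) = 1 - p ^ 8 * (p ^ 8) ^ n := by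
        rw [← pow_succ', ← pow_mul]; norm_cast
      rw [e, show ((n + 1 : ℕ) : ℤ) - 1 = n by push_cast; ring, Nat.cast_succ, key n ih] at h1
      rw [qPoch_succ (p ^ 8), mul_right_comm, mul_inv, Nat.cast_succ, h1]
      field_simp
  exact ⟨first, key n first⟩

/-! ### Euler's identity -/

/-- The series `∑ q^(i² + 2ik) / (q²;q²)_i`. -/
noncomputable def eulerSum (q : ℂ) (k : ℕ) : ℂ :=
  ∑' i : ℕ, q ^ (i ^ 2 + 2 * i * k) * (qPoch (q ^ 2) (q ^ 2) i)⁻¹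

theorem summable_pow_sq {x : ℝ} (hx0 : 0 ≤ x) (hx1 : x < 1) : Summable fun i : ℕ => x ^ (i ^ 2) :=
  Summable.of_nonneg_of_le (fun i => by positivity)
    (fun i => pow_le_pow_of_le_one hx0 hx1.le (Nat.le_self_pow (by norm_num) i))
    (summable_geometric_of_lt_one hx0 hx1)

theorem norm_pow_sq_lt_one {q : ℂ} (hq : ‖q‖ < 1) : ‖q ^ 2‖ < 1 := by
  rw [norm_pow]; exact pow_lt_one₀ (norm_nonneg _) hq (by norm_num)

theorem exists_norm_eulerSum_term_le {q : ℂ} (hq : ‖q‖ < 1) : ∃ C : ℝ, 0 < C ∧ ∀ i k : ℕ,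
    ‖q ^ (i ^ 2 + 2 * i * k) * (qPoch (q ^ 2) (q ^ 2) i)⁻¹‖ ≤ ‖q‖ ^ (i ^ 2) * C := by
  obtain ⟨C, hC0, hC⟩ := exists_norm_inv_qPoch_le (norm_pow_sq_lt_one hq) (norm_pow_sq_lt_one hq)
  refine ⟨C, hC0, fun i k => ?_⟩
  rw [norm_mul, norm_pow]
  exact mul_le_mul (pow_le_pow_of_le_one (norm_nonneg _) hq.le (Nat.le_add_right _ _)) (hC i)
    (norm_nonneg _) (by positivity)

theorem summable_eulerSum {q : ℂ} (hq : ‖q‖ < 1) (k : ℕ) :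
    Summable fun i : ℕ => q ^ (i ^ 2 + 2 * i * k) * (qPoch (q ^ 2) (q ^ 2) i)⁻¹ := by
  obtain ⟨C, hC0, hC⟩ := exists_norm_eulerSum_term_le hq
  exact Summable.of_norm_bounded ((summable_pow_sq (norm_nonneg q) hq).mul_right C) fun i => hC i k

/-- In the difference of the two sums the `i`-th term gains the factor `1 - q^(2i)`. It kills `i =
0` and cancels the last factor of `(q²;q²)_i` otherwise; shifting `i` gives back the sum at `k + 1`.
-/
theorem eulerSum_succ {q : ℂ} (hq : ‖q‖ < 1) (k : ℕ) :
    eulerSum q k = (1 - -q * (q ^ 2) ^ k) * eulerSum q (k + 1) := by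
  have h : eulerSum q k - eulerSum q (k + 1) = q * (q ^ 2) ^ k * eulerSum q (k + 1) := by
    rw [eulerSum, eulerSum, ← (summable_eulerSum hq _).tsum_sub (summable_eulerSum hq _),
      ((summable_eulerSum hq _).sub (summable_eulerSum hq _)).tsum_eq_zero_add, ← tsum_mul_left]
    simp only [zero_pow two_ne_zero, mul_zero, zero_mul, add_zero, sub_self, zero_add]
    refine tsum_congr fun i => ?_
    have h0 := one_sub_mul_pow_ne_zero (norm_pow_sq_lt_one hq) (norm_pow_sq_lt_one hq) i
    have h1 := qPoch_ne_zero (norm_pow_sq_lt_one hq) (norm_pow_sq_lt_one hq) i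
    rw [qPoch_succ, mul_inv]
    field_simp
    ring
  linear_combination h

theorem tendsto_eulerSum {q : ℂ} (hq : ‖q‖ < 1) : Tendsto (eulerSum q) atTop (𝓝 1) := by
  obtain ⟨C, hC0, hC⟩ := exists_norm_eulerSum_term_le hq
  have h : Tendsto (eulerSum q) atTop (𝓝 (∑' i : ℕ, if i = 0 then 1 else 0)) := by
    refine tendsto_tsum_of_dominated_convergence
      ((summable_pow_sq (norm_nonneg q) hq).mul_right C) (fun i => ?_)
      (Eventually.of_forall fun k i => hC i k)
    split_ifs with h
    · subst h; simp [qPoch_zero]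
    · have h1 : Tendsto (fun k : ℕ => (q ^ (2 * i)) ^ k) atTop (𝓝 0) :=
        tendsto_pow_atTop_nhds_zero_of_norm_lt_one
          (by rw [norm_pow]; exact pow_lt_one₀ (norm_nonneg _) hq (by omega))
      simpa [pow_add, pow_mul] using
        (h1.const_mul (q ^ (i ^ 2))).mul_const (qPoch (q ^ 2) (q ^ 2) i)⁻¹
  simpa using h

theorem eulerSum_zero_eq {q : ℂ} (hq : ‖q‖ < 1) (k : ℕ) :
    eulerSum q 0 = qPoch (-q) (q ^ 2) k * eulerSum q k := by
  induction k with
  | zero => simp [qPoch_zero]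
  | succ k ih => rw [ih, eulerSum_succ hq, qPoch_succ, mul_assoc]

theorem eulerSum_zero {q : ℂ} (hq : ‖q‖ < 1) : eulerSum q 0 = qPochInf (-q) (q ^ 2) := by
  have h := (tendsto_qPoch (-q) (norm_pow_sq_lt_one hq)).mul (tendsto_eulerSum hq)
  simp_rw [← eulerSum_zero_eq hq] at h
  simpa using tendsto_nhds_unique tendsto_const_nhds h

/-! ### The Bailey chain and the double series -/

theorem Summable.mul_prod_norm_bounded {ι κ : Type*} {v : ι → ℂ} {w : κ → ℂ} {f : ι × κ → ℂ} {C : ℝ}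
    (hv : Summable fun r => ‖v r‖) (hw : Summable fun r => ‖w r‖) (hf : ∀ x, ‖f x‖ ≤ C) :
    Summable fun x : ι × κ => v x.1 * w x.2 * f x :=
  (hv.mul_norm hw).mul_norm_bounded hf

theorem exists_norm_finTheta_le {p P : ℂ} (hp0 : p ≠ 0) (hp1 : ‖p‖ < 1) (hP : ‖P‖ < 1) {a : ℤ}
    (ha : 0 < a) (b : ℤ) : ∃ C : ℝ, 0 < C ∧ ∀ n m, ‖finTheta p P a b n m‖ ≤ C := by
  obtain ⟨C, hC0, hC⟩ := exists_norm_qInv_le hP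
  have hs := (summable_norm_thetaTerm hp0 hp1 ha b).mul_right (C * C)
  refine ⟨∑' r, ‖thetaTerm p a b r‖ * (C * C) + 1, ?_, fun n m => ?_⟩
  · have : 0 ≤ ∑' r, ‖thetaTerm p a b r‖ * (C * C) := tsum_nonneg fun r => by positivity
    linarith
  · refine (tsum_of_norm_bounded hs.hasSum fun r => ?_).trans (by linarith)
    rw [norm_mul]
    exact mul_le_mul_of_nonneg_left (norm_mul_le_of_le_bound hC0 (hC _) (hC _)) (norm_nonneg _)

/-- One step along the Bailey chain. -/
theorem tsum_mul_finTheta {p : ℂ} (hp0 : p ≠ 0) (hp1 : ‖p‖ < 1) {Q : ℂ} (hQ0 : Q ≠ 0) (hQ : ‖Q‖ < 1)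
    {a : ℤ} (ha : 0 < a) (b N e : ℤ) :
    ∑' k : ℤ, Q ^ (k ^ 2 + e * k) * (qInv Q (N - k) * finTheta p Q a b k (k + e)) =
      ∑' r : ℤ, thetaTerm p a b r * (Q ^ (r ^ 2 + e * r) * (qInv Q (N - r) * qInv Q (N + r + e))) := by
  obtain ⟨C, hC0, hC⟩ := exists_norm_qInv_le hQ
  -- Absolute convergence of the double series permits summing over `k` first, where `tsum_bailey`
  -- applies.
  have hs : Summable fun x : ℤ × ℤ => Q ^ (1 * x.1 ^ 2 + e * x.1) * thetaTerm p a b x.2 *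
      (qInv Q (N - x.1) * qInv Q (x.1 - x.2) * qInv Q (x.1 + x.2 + e)) :=
    (summable_norm_zpow_quadratic hQ0 hQ one_pos e).mul_prod_norm_bounded
      (summable_norm_thetaTerm hp0 hp1 ha b)
      fun x => norm_mul_mul_le_of_le_bound hC0 (hC _) (hC _) (hC _)
  calc _ = ∑' k : ℤ, ∑' r : ℤ, Q ^ (1 * k ^ 2 + e * k) * thetaTerm p a b r *
      (qInv Q (N - k) * qInv Q (k - r) * qInv Q (k + r + e)) := by
        refine tsum_congr fun k => ?_
        rw [finTheta, ← tsum_mul_left, ← tsum_mul_left]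
        refine tsum_congr fun r => ?_
        rw [show k + e + r = k + r + e by ring, one_mul]
        ring
    _ = ∑' r : ℤ, ∑' k : ℤ, Q ^ (1 * k ^ 2 + e * k) * thetaTerm p a b r *
      (qInv Q (N - k) * qInv Q (k - r) * qInv Q (k + r + e)) := hs.tsum_comm.symm
    _ = _ := by
        refine tsum_congr fun r => ?_
        rw [← tsum_bailey hQ0 hQ, ← tsum_mul_left]
        refine tsum_congr fun k => ?_
        rw [one_mul]
        ring

theorem summable_chain {p : ℂ} (hp0 : p ≠ 0) (hp1 : ‖p‖ < 1) {Q : ℂ} (hQ0 : Q ≠ 0) (hQ : ‖Q‖ < 1)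
    {a : ℤ} (ha : 0 < a) (b e f : ℤ) :
    Summable fun x : ℤ × ℤ => Q ^ (1 * x.1 ^ 2 + f * x.1) * Q ^ (1 * x.2 ^ 2 + e * x.2) *
      (qInv Q (x.1 - x.2) * finTheta p Q a b x.2 (x.2 + e)) := by
  obtain ⟨C, hC0, hC⟩ := exists_norm_qInv_le hQ
  obtain ⟨D, hD0, hD⟩ := exists_norm_finTheta_le hp0 hp1 hQ ha b
  refine Summable.mul_prod_norm_bounded (C := C * D)
    (v := fun r => Q ^ (1 * r ^ 2 + f * r)) (w := fun r => Q ^ (1 * r ^ 2 + e * r))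
    (f := fun x => qInv Q (x.1 - x.2) * finTheta p Q a b x.2 (x.2 + e))
    (summable_norm_zpow_quadratic hQ0 hQ one_pos f)
    (summable_norm_zpow_quadratic hQ0 hQ one_pos e) fun x => ?_
  rw [norm_mul]
  exact mul_le_mul (hC _) (hD _ _) (norm_nonneg _) hC0.le

/-- The double series that remains after summing over the first index. -/
noncomputable def doubleTerm (p : ℂ) (x : ℤ × ℤ) : ℂ :=
  (p ^ 4) ^ (1 * x.1 ^ 2 + 1 * x.1) * (p ^ 4) ^ (1 * x.2 ^ 2 + 0 * x.2) *
      (qInv (p ^ 4) (x.1 - x.2) * finTheta p (p ^ 4) 3 1 x.2 (x.2 + 0)) +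
    p ^ 4 * ((p ^ 4) ^ (1 * x.1 ^ 2 + 2 * x.1) * (p ^ 4) ^ (1 * x.2 ^ 2 + 1 * x.2) *
      (qInv (p ^ 4) (x.1 - x.2) * finTheta p (p ^ 4) 3 1 x.2 (x.2 + 1)))

theorem summable_doubleTerm {p : ℂ} (hp0 : p ≠ 0) (hp1 : ‖p‖ < 1) : Summable (doubleTerm p) := by
  have hQ : ‖p ^ 4‖ < 1 := by rw [norm_pow]; exact pow_lt_one₀ (norm_nonneg _) hp1 (by norm_num)
  exact (summable_chain hp0 hp1 (pow_ne_zero 4 hp0) hQ three_pos 1 0 1).add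
    ((summable_chain hp0 hp1 (pow_ne_zero 4 hp0) hQ three_pos 1 1 2).mul_left _)

theorem thetaTerm_mul_sq {p : ℂ} (hp0 : p ≠ 0) (a b c d r : ℤ) :
    thetaTerm p a b r * p ^ (c * r ^ 2 + d * r) = thetaTerm p (a + c) (b + d) r := by
  rw [thetaTerm, thetaTerm, mul_assoc, ← zpow_add₀ hp0]; congr 2; ring

/-- A chain step with `e = 0` and one with `e = 1` give theta terms with linear coefficients `1` and
`5`, the latter carrying an extra `Q^r`. Together with the prefactor `Q^(N+1)` this is `Q^(N+r+1)`,
which cancels the negative part of `1/(Q;Q)_{N+r} = (1 - Q^(N+r+1)) / (Q;Q)_{N+r+1}`. -/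
theorem tsum_doubleTerm_right {p : ℂ} (hp0 : p ≠ 0) (hp1 : ‖p‖ < 1) (N : ℤ) :
    ∑' k, doubleTerm p (N, k) = ∑' r : ℤ, (p ^ 4) ^ (1 * N ^ 2 + 1 * N) * thetaTerm p 7 1 r *
      (qInv (p ^ 4) (N - r) * qInv (p ^ 4) (N + r + 1)) := by
  have hQ : ‖p ^ 4‖ < 1 := by rw [norm_pow]; exact pow_lt_one₀ (norm_nonneg _) hp1 (by norm_num)
  have hQ0 := pow_ne_zero 4 hp0
  have h7 : (0 : ℤ) < 7 := by norm_num
  have e7 (b c d r : ℤ) (hcd : d = b + 4 * c) :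
      thetaTerm p 3 b r * (p ^ 4) ^ (r ^ 2 + c * r) = thetaTerm p 7 d r := by
    rw [← zpow_natCast p, ← zpow_mul, show ((4 : ℕ) : ℤ) * (r ^ 2 + c * r) = 4 * r ^ 2 + (4 * c) * r by
      push_cast; ring, thetaTerm_mul_sq hp0, hcd]; norm_num
  have hs (b n m : ℤ) : Summable fun r : ℤ =>
      thetaTerm p 7 b r * (qInv (p ^ 4) (n - r) * qInv (p ^ 4) (m + r)) :=
    summable_finTheta hp0 hp1 hQ h7 b n m
  have hsum := summable_chain hp0 hp1 hQ0 hQ three_pos 1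
  have key (e f d : ℤ) (hd : d = 1 + 4 * e) :
      ∑' k : ℤ, (p ^ 4) ^ (1 * N ^ 2 + f * N) * (p ^ 4) ^ (1 * k ^ 2 + e * k) *
        (qInv (p ^ 4) (N - k) * finTheta p (p ^ 4) 3 1 k (k + e)) =
      (p ^ 4) ^ (1 * N ^ 2 + f * N) *
        ∑' r : ℤ, thetaTerm p 7 d r * (qInv (p ^ 4) (N - r) * qInv (p ^ 4) (N + e + r)) := by
    simp_rw [mul_assoc, tsum_mul_left, one_mul]
    rw [tsum_mul_finTheta hp0 hp1 hQ0 hQ three_pos]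
    congr 1
    refine tsum_congr fun r => ?_
    rw [← mul_assoc, e7 1 e d r hd, add_right_comm]
  simp only [doubleTerm]
  rw [((hsum 0 1).prod_factor N).tsum_add (((hsum 1 2).prod_factor N).mul_left _), tsum_mul_left]
  simp only
  rw [key 0 1 1 (by norm_num), key 1 2 5 (by norm_num), ← tsum_mul_left, ← tsum_mul_left,
    ← tsum_mul_left, ← ((hs _ _ _).mul_left _).tsum_add (((hs _ _ _).mul_left _).mul_left _)]
  refine tsum_congr fun r => ?_
  have h := qInv_sub_one hQ (N + r + 1)
  rw [show N + r + 1 - 1 = N + r by ring] at h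
  rw [add_zero, h, show N + 1 + r = N + r + 1 by ring, show thetaTerm p 7 5 r = thetaTerm p 7 1 r * (p ^ 4) ^ r by
    rw [← zpow_natCast p, ← zpow_mul]; exact (thetaTerm_mul hp0 7 1 4 r).symm,
    show 1 * N ^ 2 + 2 * N = (1 * N ^ 2 + 1 * N) + N by ring, zpow_add₀ hQ0 _ N, zpow_add₀ hQ0 _ 1,
    zpow_add₀ hQ0 N, zpow_one]
  ring

/-- With `r` fixed, the sum over `N` is `tsum_bailey_limit` with `e = 1`; its factor `Q^(r²+r) =
p^(4r²+4r)` raises `7r²+r` to `11r²+5r`. -/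
theorem tsum_doubleTerm {p : ℂ} (hp0 : p ≠ 0) (hp1 : ‖p‖ < 1) :
    ∑' x, doubleTerm p x = (qPochInf (p ^ 4) (p ^ 4))⁻¹ * ∑' r, thetaTerm p 11 5 r := by
  have hQ : ‖p ^ 4‖ < 1 := by rw [norm_pow]; exact pow_lt_one₀ (norm_nonneg _) hp1 (by norm_num)
  have hQ0 := pow_ne_zero 4 hp0
  obtain ⟨C, hC0, hC⟩ := exists_norm_qInv_le hQ
  have h7 : (0 : ℤ) < 7 := by norm_num
  have hs : Summable fun x : ℤ × ℤ => (p ^ 4) ^ (1 * x.1 ^ 2 + 1 * x.1) * thetaTerm p 7 1 x.2 *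
      (qInv (p ^ 4) (x.1 - x.2) * qInv (p ^ 4) (x.1 + x.2 + 1)) :=
    Summable.mul_prod_norm_bounded
      (v := fun r => (p ^ 4) ^ (1 * r ^ 2 + 1 * r)) (w := thetaTerm p 7 1)
      (f := fun x : ℤ × ℤ => qInv (p ^ 4) (x.1 - x.2) * qInv (p ^ 4) (x.1 + x.2 + 1))
      (summable_norm_zpow_quadratic hQ0 hQ one_pos 1)
      (summable_norm_thetaTerm hp0 hp1 h7 1)
      fun x => norm_mul_le_of_le_bound hC0 (hC _) (hC _)
  rw [(summable_doubleTerm hp0 hp1).tsum_prod, tsum_congr (tsum_doubleTerm_right hp0 hp1),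
    ← Summable.tsum_comm (f := fun N r : ℤ => (p ^ 4) ^ (1 * N ^ 2 + 1 * N) * thetaTerm p 7 1 r *
      (qInv (p ^ 4) (N - r) * qInv (p ^ 4) (N + r + 1))) hs, ← tsum_mul_left]
  refine tsum_congr fun r => ?_
  have h := tsum_bailey_limit hQ0 hQ r 1
  rw [show thetaTerm p 11 5 r = thetaTerm p 7 1 r * (p ^ 4) ^ (r ^ 2 + 1 * r) by
    rw [← zpow_natCast p, ← zpow_mul, show ((4 : ℕ) : ℤ) * (r ^ 2 + 1 * r) = 4 * r ^ 2 + 4 * r by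
      push_cast; ring, thetaTerm_mul_sq hp0]; norm_num, mul_left_comm, mul_comm (_⁻¹), ← h,
    ← tsum_mul_left]
  refine tsum_congr fun k => ?_
  rw [one_mul (k ^ 2)]
  ring

/-- The terms vanish unless `0 ≤ k ≤ N`, which is the image of `(j, k) ↦ (j + k, k)`. -/
theorem tsum_doubleTerm_nat (p : ℂ) :
    ∑' x : ℕ × ℕ, doubleTerm p ((x.1 : ℤ) + x.2, (x.2 : ℤ)) = ∑' x, doubleTerm p x := by
  refine Function.Injective.tsum_eq (g := fun x : ℕ × ℕ => ((x.1 : ℤ) + x.2, (x.2 : ℤ))) ?_ ?_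
  · rintro ⟨a, b⟩ ⟨c, d⟩ h
    simp only [Prod.mk.injEq] at h ⊢
    omega
  · rintro ⟨N, k⟩ h
    -- If `r ≤ k ≤ -1`, then `k + e + r ≤ e - 2 < 0`; this is where `e ≤ 1` matters.
    have hft (e : ℤ) (he : e ≤ 1) (hk : k < 0) : finTheta p (p ^ 4) 3 1 k (k + e) = 0 := by
      refine (tsum_congr fun r => ?_).trans tsum_zero
      rcases lt_or_ge k r with h' | h'
      · rw [qInv_of_neg _ (show k - r < 0 by omega)]; simp
      · rw [qInv_of_neg _ (show k + e + r < 0 by omega)]; simp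
    have hk : 0 ≤ k := by
      by_contra hk
      exact h (by simp only [doubleTerm, hft 0 (by norm_num) (not_le.1 hk),
        hft 1 le_rfl (not_le.1 hk)]; simp)
    have hN : k ≤ N := by
      by_contra hN
      exact h (by simp only [doubleTerm, qInv_of_neg _ (show N - k < 0 by omega)]; simp)
    exact ⟨((N - k).toNat, k.toNat), by ext <;> simp <;> omega⟩

/-! ### The triple series -/

theorem qPoch_mul_qPoch_mul_qPoch (q : ℂ) (n : ℕ) :
    qPoch (-q) (q ^ 2) n * qPoch q (q ^ 2) n * qPoch (q ^ 4) (q ^ 4) n =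
      qPoch (q ^ 2) (q ^ 2) (2 * n) := by
  induction n with
  | zero => simp [qPoch_zero]
  | succ n ih =>
    rw [show 2 * (n + 1) = 2 * n + 1 + 1 by ring, qPoch_succ (q ^ 2), qPoch_succ (q ^ 2), ← ih]
    simp only [qPoch_succ]
    ring

theorem qPochInf_mul_qPochInf_mul_qPochInf {q : ℂ} (hq : ‖q‖ < 1) :
    qPochInf (-q) (q ^ 2) * qPochInf q (q ^ 2) * qPochInf (q ^ 4) (q ^ 4) =
      qPochInf (q ^ 2) (q ^ 2) := by
  have h2 := norm_pow_sq_lt_one hq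
  have h4 : ‖q ^ 4‖ < 1 := by rw [norm_pow]; exact pow_lt_one₀ (norm_nonneg _) hq (by norm_num)
  have h := ((tendsto_qPoch (-q) h2).mul (tendsto_qPoch q h2)).mul (tendsto_qPoch (q ^ 4) h4)
  simp_rw [qPoch_mul_qPoch_mul_qPoch] at h
  exact tendsto_nhds_unique h ((tendsto_qPoch _ h2).comp
    (tendsto_id.const_mul_atTop' two_pos))

/-- The general term of the triple series. -/
noncomputable def tripleTerm (q : ℂ) (i j k : ℕ) : ℂ :=
  q ^ (i ^ 2 + 2 * j ^ 2 + 4 * k ^ 2 + 2 * i * k + 4 * j * k + 2 * j + 2 * k) *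
      (1 + q ^ (2 * i + 2 * j + 4 * k + 2)) /
    (qPoch (q ^ 2) (q ^ 2) i * qPoch (q ^ 2) (q ^ 2) j * qPoch (q ^ 4) (q ^ 4) k)

theorem summable_tripleTerm {q : ℂ} (hq : ‖q‖ < 1) :
    Summable fun n : ℕ × ℕ × ℕ => tripleTerm q n.1 n.2.1 n.2.2 := by
  have h2 := norm_pow_sq_lt_one hq
  have h4 : ‖q ^ 4‖ < 1 := by rw [norm_pow]; exact pow_lt_one₀ (norm_nonneg _) hq (by norm_num)
  obtain ⟨C, hC0, hC⟩ := exists_norm_inv_qPoch_le h2 h2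
  obtain ⟨D, hD0, hD⟩ := exists_norm_inv_qPoch_le h4 h4
  have hs : Summable fun i : ℕ => ‖q ^ (i ^ 2)‖ := by
    simp_rw [norm_pow]; exact summable_pow_sq (norm_nonneg q) hq
  -- The weight `q^(i²) q^(j²) q^(k²)` is split off for summability; the other powers of `q` have
  -- norm at most `1`, and `1 + q^m` has norm at most `2`.
  refine (hs.mul_prod_norm_bounded (hs.mul_norm hs) (C := 1 * (1 + 1) * (C * C * D))
    (f := fun n : ℕ × ℕ × ℕ =>
      q ^ (n.2.1 ^ 2 + 3 * n.2.2 ^ 2 + 2 * n.1 * n.2.2 + 4 * n.2.1 * n.2.2 + 2 * n.2.1 + 2 * n.2.2) *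
      (1 + q ^ (2 * n.1 + 2 * n.2.1 + 4 * n.2.2 + 2)) *
      ((qPoch (q ^ 2) (q ^ 2) n.1)⁻¹ * (qPoch (q ^ 2) (q ^ 2) n.2.1)⁻¹ *
        (qPoch (q ^ 4) (q ^ 4) n.2.2)⁻¹)) fun n => ?_).congr fun n => ?_
  · have hpow (m : ℕ) : ‖q ^ m‖ ≤ 1 := by
      rw [norm_pow]; exact pow_le_one₀ (norm_nonneg _) hq.le
    simp only [norm_mul]
    gcongr
    · exact hpow _
    · exact (norm_add_le _ _).trans (add_le_add (by simp) (hpow _))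
    · exact hC _
    · exact hC _
    · exact hD _
  · simp only [tripleTerm, div_eq_mul_inv, mul_inv]
    ring

/-- The factor `q^(2i)` in the second summand moves Euler's sum from `k` to `k + 1`, which is why
the Bailey pairs with `e = 0` and `e = 1` both occur. -/
theorem tsum_tripleTerm_left {p : ℂ} (hp0 : p ≠ 0) (hp1 : ‖p‖ < 1) (j k : ℕ) :
    ∑' i, tripleTerm (p ^ 2) i j k =
      qPochInf (-p ^ 2) ((p ^ 2) ^ 2) * doubleTerm p ((j : ℤ) + k, (k : ℤ)) := by
  have hq := norm_pow_sq_lt_one hp1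
  have hq2 : (p ^ 2) ^ 2 = p ^ 4 := by ring
  have hpp : ‖p ^ 4‖ < 1 := by rw [norm_pow]; exact pow_lt_one₀ (norm_nonneg _) hp1 (by norm_num)
  have hn : ‖-p ^ 2‖ < 1 := by rwa [norm_neg]
  have he (k : ℕ) : eulerSum (p ^ 2) k =
      qPochInf (-p ^ 2) ((p ^ 2) ^ 2) * (qPoch (-p ^ 2) (p ^ 4) k)⁻¹ := by
    have h0 : qPoch (-p ^ 2) (p ^ 4) k ≠ 0 := qPoch_ne_zero hn hpp k
    rw [← eulerSum_zero hq, eulerSum_zero_eq hq k, hq2]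
    field_simp
  set M := (p ^ 2) ^ (2 * j ^ 2 + 4 * k ^ 2 + 4 * j * k + 2 * j + 2 * k) *
    ((qPoch (p ^ 4) (p ^ 4) j)⁻¹ * (qPoch (p ^ 8) (p ^ 8) k)⁻¹) with hM
  have hsum : ∑' i, tripleTerm (p ^ 2) i j k =
      M * eulerSum (p ^ 2) k + M * (p ^ 2) ^ (2 * j + 4 * k + 2) * eulerSum (p ^ 2) (k + 1) := by
    rw [eulerSum, eulerSum, ← tsum_mul_left, ← tsum_mul_left,
      ← ((summable_eulerSum hq _).mul_left _).tsum_add ((summable_eulerSum hq _).mul_left _)]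
    refine tsum_congr fun i => ?_
    rw [tripleTerm, hM, hq2, show (p ^ 2) ^ 4 = p ^ 8 by ring]
    simp only [div_eq_mul_inv, mul_inv]
    ring
  rw [hsum, he, he, doubleTerm, add_zero, (finTheta_bailey_pair_eq hp0 hp1 k).1,
    (finTheta_bailey_pair_eq hp0 hp1 k).2, add_sub_cancel_right, qInv_natCast, hM]
  have hz (a : ℤ) (b : ℕ) (h : a = b) : (p ^ 4) ^ a = (p ^ 4) ^ b := by rw [h, zpow_natCast]
  simp only
  rw [hz (1 * ((j : ℤ) + k) ^ 2 + 1 * ((j : ℤ) + k)) (1 * (j + k) ^ 2 + 1 * (j + k)) (by push_cast; ring),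
    hz (1 * (k : ℤ) ^ 2 + 0 * (k : ℤ)) (k ^ 2) (by push_cast; ring),
    hz (1 * ((j : ℤ) + k) ^ 2 + 2 * ((j : ℤ) + k)) (1 * (j + k) ^ 2 + 2 * (j + k)) (by push_cast; ring),
    hz (1 * (k : ℤ) ^ 2 + 1 * (k : ℤ)) (k ^ 2 + k) (by push_cast; ring)]
  simp only [mul_inv]
  ring

theorem tsum_tripleTerm {p : ℂ} (hp0 : p ≠ 0) (hp1 : ‖p‖ < 1) :
    ∑' n : ℕ × ℕ × ℕ, tripleTerm (p ^ 2) n.1 n.2.1 n.2.2 =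
      qPochInf (-p ^ 2) ((p ^ 2) ^ 2) *
        ((qPochInf (p ^ 4) (p ^ 4))⁻¹ * ∑' r, thetaTerm p 11 5 r) := by
  have hs := summable_tripleTerm (norm_pow_sq_lt_one hp1)
  rw [hs.tsum_prod, ← Summable.tsum_comm (f := fun (i : ℕ) (x : ℕ × ℕ) => tripleTerm (p ^ 2) i x.1 x.2) hs]
  simp_rw [tsum_tripleTerm_left hp0 hp1]
  rw [tsum_mul_left, tsum_doubleTerm_nat, tsum_doubleTerm hp0 hp1]

theorem hasSum_tripleTerm_zero :
    HasSum (fun n : ℕ × ℕ × ℕ => tripleTerm 0 n.1 n.2.1 n.2.2)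
      (qPochInf₃ (0 ^ 3) (0 ^ 8) (0 ^ 11) (0 ^ 11) / (qPochInf 0 (0 ^ 2) * qPochInf (0 ^ 4) (0 ^ 4))) := by
  have h := hasSum_single (f := fun n : ℕ × ℕ × ℕ => tripleTerm 0 n.1 n.2.1 n.2.2) 0 (by
    rintro ⟨i, j, k⟩ hn
    have : i ^ 2 + 2 * j ^ 2 + 4 * k ^ 2 + 2 * i * k + 4 * j * k + 2 * j + 2 * k ≠ 0 := by
      intro h0
      apply hn
      simp only [Nat.add_eq_zero_iff, pow_eq_zero_iff two_ne_zero, mul_eq_zero] at h0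
      simp only [Prod.ext_iff, Prod.fst_zero, Prod.snd_zero]
      omega
    simp only [tripleTerm, zero_pow this, zero_mul, zero_div])
  simpa [tripleTerm, qPoch_zero, qPochInf₃, qPochInf] using h

theorem mainTheorem5 (q : ℂ) (hq : ‖q‖ < 1) :
    HasSum
      (fun n : ℕ × ℕ × ℕ =>
        let i := n.1
        let j := n.2.1
        let k := n.2.2
        q ^ (i ^ 2 + 2 * j ^ 2 + 4 * k ^ 2 + 2 * i * k + 4 * j * k + 2 * j + 2 * k) *
            (1 + q ^ (2 * i + 2 * j + 4 * k + 2)) /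
          (qPoch (q ^ 2) (q ^ 2) i * qPoch (q ^ 2) (q ^ 2) j * qPoch (q ^ 4) (q ^ 4) k))
      (qPochInf₃ (q ^ 3) (q ^ 8) (q ^ 11) (q ^ 11) /
        (qPochInf q (q ^ 2) * qPochInf (q ^ 4) (q ^ 4))) := by
  -- Integer powers of `p` require `p ≠ 0`; at `q = 0` only the term `i = j = k = 0` survives.
  rcases eq_or_ne q 0 with rfl | hq0
  · exact hasSum_tripleTerm_zero
  -- A square root of `q` makes theta exponents such as `(11r² + 5r)/2` have integer coefficients.
  obtain ⟨p, rfl⟩ := IsAlgClosed.exists_pow_nat_eq q two_pos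
  have hp0 : p ≠ 0 := by rintro rfl; simp at hq0
  have hp1 : ‖p‖ < 1 := by
    rw [norm_pow] at hq
    exact (pow_lt_one_iff_of_nonneg (norm_nonneg p) two_ne_zero).1 hq
  have h4 : ‖(p ^ 2) ^ 4‖ < 1 := by rw [norm_pow]; exact pow_lt_one₀ (norm_nonneg _) hq (by norm_num)
  have h := (summable_tripleTerm hq).hasSum
  rw [tsum_tripleTerm hp0 hp1, tsum_thetaTerm hp0 hp1 (d := 22) (by norm_num) (by norm_num)] at h
  refine (congrArg (HasSum _) ?_).mp h
  have e := qPochInf_mul_qPochInf_mul_qPochInf hq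
  have n1 := qPochInf_ne_zero hq (norm_pow_sq_lt_one hq)
  have n2 := qPochInf_ne_zero h4 h4
  have n3 := qPochInf_ne_zero (norm_pow_sq_lt_one hq) (norm_pow_sq_lt_one hq)
  have z1 : p ^ ((11 : ℤ) + 5) = (p ^ 2) ^ 8 := by rw [← pow_mul]; norm_cast
  have z2 : p ^ ((11 : ℤ) - 5) = (p ^ 2) ^ 3 := by rw [← pow_mul]; norm_cast
  rw [z1, z2, show p ^ 22 = (p ^ 2) ^ 11 by ring, show p ^ 4 = (p ^ 2) ^ 2 by ring, ← e, qPochInf₃]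
  rw [← e] at n3
  -- `(-q;q²)_∞` is nonzero as a factor of `(q²;q²)_∞`, so it cancels from the quotient.
  have n4 := (mul_ne_zero_iff.1 (mul_ne_zero_iff.1 n3).1).1
  generalize qPochInf (-p ^ 2) _ = A at *
  generalize qPochInf (p ^ 2) _ = B at *
  generalize qPochInf ((p ^ 2) ^ 4) _ = D at *
  field_simp
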